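/- Let $\alpha\ge 0$ and $\nu$ be real numbers with $\alpha+\nu<1$, let $2\le p\le\infty$, and let $q=p/(p-1)\in[1,2]$ be the conjugate exponent ($q=1$ and $1/p=0$ if $p=\infty$). For $\mu\in\mathbb{C}$ and $x>0$ let $$K_\mu(x)=\int_0^\infty e^{-x\cosh u}\cosh(\mu u)\,du$$ be the Macdonald function (the modified Bessel function of the second kind). Let $L_{\nu,p}(\mathbb{R}_+)$ be the space of measurable functions $f:(0,\infty)\to\mathbb{C}$ with finite norm $$\|f\|_{\nu,p}=\left(\int_0^\infty x^{\nu p-1}|f(x)|^p\,dx\right)^{1/p}\quad(p<\infty),\qquad \|f\|_{\nu,\infty}=\operatorname*{ess\,sup}_{x>0}|x^\nu f(x)|.$$ Then for every $f\in L_{\nu,p}(\mathbb{R}_+)$ the integral $$(F_\alpha f)(\tau)=\int_0^\infty\left|K_{(i\tau+\alpha)/2}(x)\right|^2 f(x)\,dx$$ converges absolutely for every $\tau\in\mathbb{R}$, and $F_\alpha$ is a bounded linear operator from $L_{\nu,p}(\mathbb{R}_+)$ to $L_p(\mathbb{R})$, with $$\|F_\alpha f\|_{L_p(\mathbb{R})}\le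 \pi^{1/p}\,2^{-2/q-\nu}\,q^{\nu-1}\left[\Gamma\left(\frac q2(1-\nu)\right)\right]^{2/q} B\left(\frac{1-\nu+\alpha}{2},\frac{1-\nu-\alpha}{2}\right)\|f\|_{\nu,p},$$ where $\Gamma$ and $B$ are Euler's gamma and beta functions. -/

import Mathlib

open MeasureTheory Set
open scoped ENNReal

noncomputable section

/-- The Macdonald function (modified Bessel function of the second kind)
`K_μ(z) = ∫_0^∞ e^{-z cosh u} cosh (μ u) du`, for complex order `μ` and `Re z > 0`. -/
def macdonald (μ z : ℂ) : ℂ :=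
  ∫ u : ℝ in Ioi 0, Complex.exp (-z * Complex.cosh u) * Complex.cosh (μ * u)

/-- The kernel `|K_{(iτ+α)/2}(x)|²`. -/
def lebedevKernel (α τ x : ℝ) : ℝ :=
  ‖macdonald ((Complex.I * τ + α) / 2) x‖ ^ 2

/-- The index transform `F_α(τ) = ∫_0^∞ |K_{(iτ+α)/2}(x)|² f(x) dx`. -/
def lebedevTransform (α : ℝ) (f : ℝ → ℂ) (τ : ℝ) : ℂ :=
  ∫ x in Ioi (0 : ℝ), (lebedevKernel α τ x : ℂ) * f x

/-- The norm of `L_{ν,p}(ℝ_+)`: `(∫_0^∞ x^{νp-1} |f(x)|^p dx)^{1/p}` for finite `p`, and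
`ess sup_{x > 0} |x^ν f(x)|` for `p = ∞`, with values in `[0, ∞]`. -/
def weightedNorm (ν : ℝ) (p : ℝ≥0∞) (f : ℝ → ℂ) : ℝ≥0∞ :=
  if p = ∞ then
    essSup (fun x : ℝ => ENNReal.ofReal (x ^ ν) * ‖f x‖ₑ) (volume.restrict (Ioi 0))
  else
    (∫⁻ x in Ioi (0 : ℝ), ENNReal.ofReal (x ^ (ν * p.toReal - 1)) * ‖f x‖ₑ ^ p.toReal)
      ^ (1 / p.toReal)

/-- Membership in `L_{ν,p}(ℝ_+)`; only the values of `f` on `(0, ∞)` matter. -/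
def MemWeightedLp (ν : ℝ) (p : ℝ≥0∞) (f : ℝ → ℂ) : Prop :=
  AEStronglyMeasurable f (volume.restrict (Ioi 0)) ∧ weightedNorm ν p f < ∞

end

/-!
The index transform is a Fourier integral in disguise. The product formula
`|K_{(iτ+α)/2}(x)|² = ∫_ℝ e ^ (iτt) K_α(2x cosh t) dt` (`lebedevKernel_eq_integral`), which comes
from writing both Macdonald functions as integrals over the line and substituting `u = s + t`,
`v = s - t`, gives `F_α f(τ) = ∫_ℝ e ^ (iτt) h(t) dt` with
`h(t) = ∫₀^∞ K_α(2x cosh t) f(x) dx` (`lebedevTransform_eq_integral`).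

Write `β = 1 - ν`. Inserting `K_α(y) = ½ ∫_ℝ e ^ (-y cosh s) e ^ (αs) ds` and applying Hölder's
inequality in `L^p(dx / x)` for each fixed `s` gives
`|h(t)| ≤ C (cosh t) ^ (-β) ‖f‖_{ν,p}` (`lintegral_macdonaldReal_mul_le`), where `C` contains
`∫_ℝ e ^ (αs) (cosh s) ^ (-β) ds = 2 ^ (β-1) B((β+α)/2, (β-α)/2)` (`lintegral_exp_mul_cosh_rpow`).
The same beta integral, with `α = 0` and exponent `qβ`, evaluates the `L^q` norm of
`(cosh t) ^ (-β)`. The bound also makes the double integral absolutely convergent, which justifies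
the exchange of integrals and gives the absolute convergence of the transform.

The `L^p` bound is then the Hausdorff–Young inequality `‖∫ e ^ (iτt) h(t) dt‖_p ≤ (2π) ^ (1/p) ‖h‖_q`
(`eLpNorm_integral_exp_mul_le`), and the constants multiply to the stated one
(`transferConst_mul_eq`). Hausdorff–Young is proved here from Plancherel's theorem by Hadamard's
three lines theorem, applied to the bilinear form `∫ 𝓕 u · v` on simple functions; density of simple
functions in `L¹ ∩ L^q` and duality then give the general case.
-/

section HausdorffYoung

open scoped FourierTransform SchwartzMap Topology
open Filter

/-! ### Plancherel's theorem on `L¹ ∩ L²` -/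

theorem continuous_fourier {u : ℝ → ℂ} (h1 : Integrable u) : Continuous (𝓕 u) :=
  VectorFourier.fourierIntegral_continuous Real.continuous_fourierChar
    (by exact continuous_inner) h1

theorem norm_fourier_le_integral_norm (u : ℝ → ℂ) (τ : ℝ) : ‖𝓕 u τ‖ ≤ ∫ t, ‖u t‖ :=
  VectorFourier.norm_fourierIntegral_le_integral_norm _ _ _ _ _

/-- Plancherel's theorem for the Fourier integral of a function in `L¹ ∩ L²`. -/
theorem eLpNorm_fourier_two {u : ℝ → ℂ} (h1 : Integrable u) (h2 : MemLp u 2) :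
    eLpNorm (𝓕 u) 2 = eLpNorm u 2 := by
  set U : Lp ℂ 2 (volume : Measure ℝ) := h2.toLp u with hU
  have hUu : U =ᵐ[volume] u := h2.coeFn_toLp
  -- the `L²` Fourier transform of `u` agrees with the Fourier integral as a distribution
  have hae : (𝓕 U : Lp ℂ 2 (volume : Measure ℝ)) =ᵐ[volume] 𝓕 u := by
    refine ae_eq_of_integral_contDiff_smul_eq
      ((Lp.memLp _).locallyIntegrable (by norm_num))
      (continuous_fourier h1).locallyIntegrable fun g hg hgs => ?_
    have hgs' : HasCompactSupport (fun x => (g x : ℂ)) := hgs.comp_left Complex.ofReal_zero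
    have hg' : ContDiff ℝ (↑(⊤ : ℕ∞)) (fun x => (g x : ℂ)) :=
      Complex.ofRealCLM.contDiff.comp hg
    set G : 𝓢(ℝ, ℂ) := hgs'.toSchwartzMap hg' with hG
    have hGg : ∀ x, G x = (g x : ℂ) := fun x => rfl
    have key := congrArg (fun T : 𝓢'(ℝ, ℂ) => T G) (Lp.fourier_toTemperedDistribution_eq U)
    simp only [TemperedDistribution.fourier_apply, Lp.toTemperedDistribution_apply] at key
    calc ∫ x, g x • (𝓕 U : Lp ℂ 2 (volume : Measure ℝ)) x
        = ∫ x, G x • (𝓕 U : Lp ℂ 2 (volume : Measure ℝ)) x := by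
          simp [hGg]
      _ = ∫ x, (𝓕 G) x • U x := key.symm
      _ = ∫ x, 𝓕 (G : ℝ → ℂ) x • u x := by
          refine integral_congr_ae ?_
          filter_upwards [hUu] with x hx
          rw [hx, SchwartzMap.fourier_coe]
      _ = ∫ x, G x • 𝓕 u x := by
          simpa using! (VectorFourier.integral_fourierIntegral_smul_eq_flip (L := innerₗ ℝ)
            (μ := volume) (ν := volume)
            Real.continuous_fourierChar continuous_inner G.integrable h1)
      _ = ∫ x, g x • 𝓕 u x := by simp [hGg]
  rw [← eLpNorm_congr_ae hae, ← eLpNorm_congr_ae hUu]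
  have := Lp.norm_fourier_eq U
  rw [Lp.norm_def, Lp.norm_def,
    ENNReal.toReal_eq_toReal_iff' (Lp.eLpNorm_ne_top _) (Lp.eLpNorm_ne_top _)] at this
  exact this

/-! ### The Hausdorff–Young inequality for simple functions -/

theorem integrable_fourier_mul {u v : ℝ → ℂ} (hu : Integrable u) (hv : Integrable v) :
    Integrable fun τ => 𝓕 u τ * v τ :=
  hv.bdd_mul (continuous_fourier hu).aestronglyMeasurable
    (Filter.Eventually.of_forall (norm_fourier_le_integral_norm u))

/-- The endpoint `q = 1` of the bilinear Hausdorff–Young inequality. -/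
theorem norm_integral_fourier_mul_le_one {u v : ℝ → ℂ} (hv : Integrable v) :
    ‖∫ τ, 𝓕 u τ * v τ‖ ≤ (∫ t, ‖u t‖) * ∫ t, ‖v t‖ := by
  calc ‖∫ τ, 𝓕 u τ * v τ‖ ≤ ∫ τ, (∫ t, ‖u t‖) * ‖v τ‖ := by
        refine norm_integral_le_of_norm_le (hv.norm.const_mul _)
          (Filter.Eventually.of_forall fun τ => ?_)
        rw [norm_mul]
        gcongr
        exact norm_fourier_le_integral_norm u τ
    _ = _ := integral_const_mul _ _

/-- The endpoint `q = 2` of the bilinear Hausdorff–Young inequality. -/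
theorem norm_integral_fourier_mul_le_two {u v : ℝ → ℂ} (hu : Integrable u) (hu2 : MemLp u 2)
    (hv2 : MemLp v 2) :
    ‖∫ τ, 𝓕 u τ * v τ‖ ≤
      (∫ t, ‖u t‖ ^ (2 : ℝ)) ^ (1 / 2 : ℝ) * (∫ t, ‖v t‖ ^ (2 : ℝ)) ^ (1 / 2 : ℝ) := by
  have hP := eLpNorm_fourier_two hu hu2
  have hF2 : MemLp (𝓕 u) 2 := ⟨(continuous_fourier hu).aestronglyMeasurable, hP ▸ hu2.2⟩
  have hint : ∫ t, ‖𝓕 u t‖ ^ (2 : ℝ) = ∫ t, ‖u t‖ ^ (2 : ℝ) := by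
    rw [hF2.eLpNorm_eq_integral_rpow_norm (by norm_num) (by norm_num),
      hu2.eLpNorm_eq_integral_rpow_norm (by norm_num) (by norm_num),
      ENNReal.ofReal_eq_ofReal_iff (by positivity) (by positivity)] at hP
    exact (Real.rpow_left_inj (by positivity) (by positivity) (by norm_num)).1 hP
  calc ‖∫ τ, 𝓕 u τ * v τ‖ ≤ ∫ τ, ‖𝓕 u τ‖ * ‖v τ‖ := by
        simpa only [norm_mul] using norm_integral_le_integral_norm (fun τ => 𝓕 u τ * v τ)
    _ ≤ (∫ t, ‖𝓕 u t‖ ^ (2 : ℝ)) ^ (1 / 2 : ℝ) * (∫ t, ‖v t‖ ^ (2 : ℝ)) ^ (1 / 2 : ℝ) :=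
        integral_mul_norm_le_Lp_mul_Lq Real.HolderConjugate.two_two
          (by simpa using hF2) (by simpa using hv2)
    _ = _ := by rw [hint]

/-- For simple functions, the pairing `∫ 𝓕 (ψ ∘ u) · (ψ ∘ v)` is a quadratic polynomial in the
finitely many values of `ψ`. -/
theorem exists_integral_fourier_mul_eq_sum (u v : SimpleFunc ℝ ℂ) (hu : Integrable u)
    (hv : Integrable v) :
    ∃ c : ℂ → ℂ → ℂ, ∀ ψ : ℂ → ℂ, ψ 0 = 0 →
      ∫ τ, 𝓕 (fun t => ψ (u t)) τ * ψ (v τ) =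
        ∑ a ∈ u.range, ∑ b ∈ v.range, ψ a * ψ b * c a b := by
  -- the indicator of the level set at a nonzero height, which has finite measure
  set e : SimpleFunc ℝ ℂ → ℂ → ℝ → ℂ := fun w a t => if w t = a ∧ a ≠ 0 then 1 else 0 with he
  have hei : ∀ w : SimpleFunc ℝ ℂ, Integrable w → ∀ a, Integrable (e w a) := by
    intro w hw a
    by_cases ha : a = 0
    · simp [he, ha]
    have : e w a = (w ⁻¹' {a}).indicator (fun _ => (1 : ℂ)) := by
      ext t
      simp [he, ha, Set.indicator]
    rw [this, integrable_indicator_iff (w.measurableSet_fiber a)]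
    exact integrableOn_const (SimpleFunc.measure_preimage_lt_top_of_integrable w hw ha).ne
  have hsum : ∀ (w : SimpleFunc ℝ ℂ) (ψ : ℂ → ℂ), ψ 0 = 0 → ∀ t,
      ψ (w t) = ∑ a ∈ w.range, ψ a * e w a t := by
    intro w ψ hψ t
    rw [Finset.sum_eq_single (w t)]
    · by_cases h : w t = 0 <;> simp [he, h, hψ]
    · intro b _ hb
      simp [he, hb.symm]
    · intro h
      exact absurd (w.mem_range_self t) h
  refine ⟨fun a b => ∫ τ, 𝓕 (e u a) τ * e v b τ, fun ψ hψ => ?_⟩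
  have hF : ∀ τ, 𝓕 (fun t => ψ (u t)) τ = ∑ a ∈ u.range, ψ a * 𝓕 (e u a) τ := by
    intro τ
    simp_rw [Real.fourier_eq, hsum u ψ hψ, Finset.smul_sum]
    rw [integral_finsetSum]
    · refine Finset.sum_congr rfl fun a _ => ?_
      rw [← integral_const_mul]
      simp_rw [mul_smul_comm]
    · intro a _
      exact (Real.fourierIntegral_convergent_iff τ).2 ((hei u hu a).const_mul _)
  simp_rw [hF, hsum v ψ hψ, Finset.sum_mul_sum]
  rw [integral_finsetSum]
  · refine Finset.sum_congr rfl fun a _ => ?_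
    rw [integral_finsetSum]
    · refine Finset.sum_congr rfl fun b _ => ?_
      rw [← integral_const_mul]
      congr 1 with τ
      ring
    · intro b _
      refine ((integrable_fourier_mul (hei u hu a) (hei v hv b)).const_mul (ψ a * ψ b)).congr
        (Filter.Eventually.of_forall fun τ => ?_)
      simp only
      ring
  · intro a _
    refine integrable_finsetSum _ fun b _ => ?_
    refine ((integrable_fourier_mul (hei u hu a) (hei v hv b)).const_mul (ψ a * ψ b)).congr
      (Filter.Eventually.of_forall fun τ => ?_)
    simp only
    ring

/-- The analytic family `c ↦ ‖c‖ ^ (q (1 - z / 2)) · c / ‖c‖`: it has modulus `‖c‖ ^ q` on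
`re z = 0` and `‖c‖ ^ (q / 2)` on `re z = 1`, and is the identity at `z = 2 - 2 / q`. -/
noncomputable def interpFamily (q : ℝ) (z c : ℂ) : ℂ := (‖c‖ : ℂ) ^ (q * (1 - z / 2)) * (c / ‖c‖)

theorem interpFamily_zero (q : ℝ) (z : ℂ) : interpFamily q z 0 = 0 := by simp [interpFamily]

theorem norm_interpFamily {q : ℝ} (hq : 0 < q) {z : ℂ} (hz : z.re ≤ 1) (c : ℂ) :
    ‖interpFamily q z c‖ = ‖c‖ ^ (q * (1 - z.re / 2)) := by
  by_cases hc : c = 0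
  · have : q * (1 - z.re / 2) ≠ 0 := by
      have : 0 < q * (1 - z.re / 2) := mul_pos hq (by linarith)
      exact this.ne'
    simp [interpFamily, hc, Real.zero_rpow this]
  · have hc' : 0 < ‖c‖ := norm_pos_iff.2 hc
    have hre : ((q : ℂ) * (1 - z / 2)).re = q * (1 - z.re / 2) := by
      simp
    rw [interpFamily, norm_mul, Complex.norm_cpow_eq_rpow_re_of_pos hc', hre, norm_div,
      Complex.norm_real, norm_norm, div_self hc'.ne', mul_one]

theorem interpFamily_self {q : ℝ} (hq : 0 < q) (c : ℂ) :
    interpFamily q ((2 - 2 / q : ℝ) : ℂ) c = c := by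
  by_cases hc : c = 0
  · simp [hc, interpFamily_zero]
  · have hc' : (‖c‖ : ℂ) ≠ 0 := by simpa using hc
    have : (q : ℂ) * (1 - ((2 - 2 / q : ℝ) : ℂ) / 2) = 1 := by
      have : (q : ℂ) ≠ 0 := by exact_mod_cast hq.ne'
      push_cast
      field_simp
      ring
    rw [interpFamily, this, Complex.cpow_one]
    field_simp

theorem differentiable_interpFamily (q : ℝ) (c : ℂ) :
    Differentiable ℂ fun z => interpFamily q z c := by
  by_cases hc : c = 0
  · simp [hc, interpFamily_zero]
  · have hc' : (‖c‖ : ℂ) ≠ 0 := by simpa using hc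
    unfold interpFamily
    refine Differentiable.mul_const (Differentiable.const_cpow (by fun_prop) (Or.inl hc')) _

open Complex.HadamardThreeLines in
/-- The Hausdorff–Young inequality in bilinear form for simple functions, by the three lines
theorem between the trivial `L¹` bound and Plancherel's theorem. -/
theorem norm_integral_fourier_mul_le_of_simpleFunc {q : ℝ} (hq1 : 1 < q) (hq2 : q ≤ 2)
    (u v : SimpleFunc ℝ ℂ) (hu : Integrable u) (hv : Integrable v) :
    ‖∫ τ, 𝓕 (u : ℝ → ℂ) τ * v τ‖ ≤ (∫ t, ‖u t‖ ^ q) ^ (1 / q) * (∫ t, ‖v t‖ ^ q) ^ (1 / q) := by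
  have hq : 0 < q := by linarith
  obtain ⟨c, hc⟩ := exists_integral_fourier_mul_eq_sum u v hu hv
  set Φ : ℂ → ℂ := fun z =>
    ∑ a ∈ u.range, ∑ b ∈ v.range, interpFamily q z a * interpFamily q z b * c a b with hΦ
  have hΦeq : ∀ z, Φ z = ∫ τ, 𝓕 (fun t => interpFamily q z (u t)) τ * interpFamily q z (v τ) :=
    fun z => (hc _ (interpFamily_zero q z)).symm
  have hmem : ∀ (w : SimpleFunc ℝ ℂ), Integrable w → ∀ (z : ℂ) (r : ℝ≥0∞),
      MemLp (fun t => interpFamily q z (w t)) r volume := by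
    intro w hw z r
    have := SimpleFunc.memLp_of_finite_measure_preimage r (SimpleFunc.finMeasSupp_iff.1
      ((SimpleFunc.integrable_iff_finMeasSupp.1 hw).map (interpFamily_zero q z)))
    exact this
  have hint : ∀ (w : SimpleFunc ℝ ℂ), Integrable w → ∀ z : ℂ,
      Integrable (fun t => interpFamily q z (w t)) :=
    fun w hw z => memLp_one_iff_integrable.1 (hmem w hw z 1)
  set A := ∫ t, ‖u t‖ ^ q with hA
  set B := ∫ t, ‖v t‖ ^ q with hB
  have hA0 : 0 ≤ A := by positivity
  have hB0 : 0 ≤ B := by positivity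
  -- the point of the strip where the family is the identity, that is, `1 - θ / 2 = 1 / q`
  set θ : ℝ := 2 - 2 / q with hθ
  have hθ0 : 0 ≤ θ := by
    rw [hθ, sub_nonneg, div_le_iff₀ hq]; linarith
  have hθ1 : θ ≤ 1 := by
    have : 1 ≤ 2 / q := by rw [le_div_iff₀ hq]; linarith
    linarith
  have key : ‖Φ (θ : ℂ)‖ ≤ (A * B) ^ (1 - (θ : ℂ).re) *
      (A ^ (1 / 2 : ℝ) * B ^ (1 / 2 : ℝ)) ^ (θ : ℂ).re := by
    refine norm_le_interp_of_mem_verticalClosedStrip₀₁' Φ ?_ ?_ ?_ ?_ ?_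
    · simp [verticalClosedStrip, hθ0, hθ1]
    · refine Differentiable.diffContOnCl ?_
      refine Differentiable.fun_sum fun a _ => Differentiable.fun_sum fun b _ => ?_
      exact ((differentiable_interpFamily q a).mul (differentiable_interpFamily q b)).mul_const _
    · have hbd : ∀ a : ℂ, ∀ z : ℂ, 0 ≤ z.re → z.re ≤ 1 →
          ‖interpFamily q z a‖ ≤ 1 + ‖a‖ ^ q := by
        intro a z h0 h1
        rw [norm_interpFamily hq h1]
        have hexp0 : 0 ≤ q * (1 - z.re / 2) := mul_nonneg hq.le (by linarith)
        rcases le_total ‖a‖ 1 with h | h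
        · have := Real.rpow_le_one (norm_nonneg a) h hexp0
          have h2 : 0 ≤ ‖a‖ ^ q := by positivity
          linarith
        · have : ‖a‖ ^ (q * (1 - z.re / 2)) ≤ ‖a‖ ^ q :=
            Real.rpow_le_rpow_of_exponent_le h (by nlinarith)
          linarith
      refine ⟨∑ a ∈ u.range, ∑ b ∈ v.range, (1 + ‖a‖ ^ q) * (1 + ‖b‖ ^ q) * ‖c a b‖, ?_⟩
      rintro _ ⟨z, hz, rfl⟩
      obtain ⟨hz0, hz1⟩ : 0 ≤ z.re ∧ z.re ≤ 1 := by simpa [verticalClosedStrip] using hz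
      refine (norm_sum_le _ _).trans (Finset.sum_le_sum fun a _ => ?_)
      refine (norm_sum_le _ _).trans (Finset.sum_le_sum fun b _ => ?_)
      rw [norm_mul, norm_mul]
      have := hbd a z hz0 hz1
      have := hbd b z hz0 hz1
      gcongr
    · intro z hz
      have hz : z.re = 0 := by simpa using hz
      rw [hΦeq]
      refine (norm_integral_fourier_mul_le_one (hint v hv z)).trans_eq ?_
      simp [norm_interpFamily hq (show z.re ≤ 1 by linarith), hz, hA, hB]
    · intro z hz
      have hz : z.re = 1 := by simpa using hz
      rw [hΦeq]
      refine (norm_integral_fourier_mul_le_two (hint u hu z) (hmem u hu z 2)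
        (hmem v hv z 2)).trans_eq ?_
      have hpow : ∀ x : ℂ, (‖x‖ ^ (q * (1 - 1 / 2))) ^ (2 : ℝ) = ‖x‖ ^ q := by
        intro x
        rw [← Real.rpow_mul (norm_nonneg x)]
        congr 1
        ring
      simp only [norm_interpFamily hq hz.le, hz, hpow, hA, hB]
  rw [hΦeq] at key
  simp only [interpFamily_self hq, hθ, Complex.ofReal_re] at key
  refine key.trans_eq ?_
  rw [← Real.mul_rpow hA0 hB0, ← Real.mul_rpow hA0 hB0, ← Real.rpow_mul (by positivity),
    ← Real.rpow_add_of_nonneg (by positivity)]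
  · congr 1; field_simp; ring
  · linarith
  · linarith

/-! ### The Hausdorff–Young inequality on `L¹ ∩ L^q` -/

theorem fourier_sub_apply {u w : ℝ → ℂ} (hu : Integrable u) (hw : Integrable w) (τ : ℝ) :
    𝓕 (fun t => u t - w t) τ = 𝓕 u τ - 𝓕 w τ := by
  simp_rw [Real.fourier_eq, smul_sub]
  exact integral_sub ((Real.fourierIntegral_convergent_iff τ).2 hu)
    ((Real.fourierIntegral_convergent_iff τ).2 hw)

/-- The pairing `∫ 𝓕 u · v` is continuous in `L¹ × L¹`. -/
theorem tendsto_integral_fourier_mul {u v : ℝ → ℂ} (hu : Integrable u) (hv : Integrable v)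
    {u' v' : ℕ → ℝ → ℂ} (hu' : ∀ n, Integrable (u' n)) (hv' : ∀ n, Integrable (v' n))
    (hul : Tendsto (fun n => ∫ t, ‖u' n t - u t‖) atTop (𝓝 0))
    (hvl : Tendsto (fun n => ∫ t, ‖v' n t - v t‖) atTop (𝓝 0)) :
    Tendsto (fun n => ∫ τ, 𝓕 (u' n) τ * v' n τ) atTop (𝓝 (∫ τ, 𝓕 u τ * v τ)) := by
  rw [tendsto_iff_norm_sub_tendsto_zero]
  have hlim : Tendsto (fun n => (∫ t, ‖u' n t - u t‖) * ((∫ t, ‖v' n t - v t‖) + ∫ t, ‖v t‖) +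
      (∫ t, ‖u t‖) * ∫ t, ‖v' n t - v t‖) atTop (𝓝 0) := by
    simpa using (hul.mul (hvl.add_const (∫ t, ‖v t‖))).add (hvl.const_mul (∫ t, ‖u t‖))
  refine squeeze_zero (fun n => norm_nonneg _) (fun n => ?_) hlim
  have hun : Integrable fun t => u' n t - u t := (hu' n).sub hu
  have hvn : Integrable fun t => v' n t - v t := (hv' n).sub hv
  have hsplit : (∫ τ, 𝓕 (u' n) τ * v' n τ) - ∫ τ, 𝓕 u τ * v τ =
      (∫ τ, 𝓕 (fun t => u' n t - u t) τ * v' n τ) + ∫ τ, 𝓕 u τ * (v' n τ - v τ) := by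
    rw [← integral_sub (integrable_fourier_mul (hu' n) (hv' n)) (integrable_fourier_mul hu hv),
      ← integral_add (integrable_fourier_mul hun (hv' n)) (integrable_fourier_mul hu hvn)]
    congr 1 with τ
    rw [fourier_sub_apply (hu' n) hu]
    ring
  have hvle : ∫ t, ‖v' n t‖ ≤ (∫ t, ‖v' n t - v t‖) + ∫ t, ‖v t‖ := by
    rw [← integral_add hvn.norm hv.norm]
    refine integral_mono (hv' n).norm (hvn.norm.add hv.norm) fun t => ?_
    simpa using norm_add_le (v' n t - v t) (v t)
  rw [hsplit]
  refine (norm_add_le _ _).trans (add_le_add ?_ ?_)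
  · exact (norm_integral_fourier_mul_le_one (hv' n)).trans (by gcongr)
  · exact norm_integral_fourier_mul_le_one hvn

/-- The Hausdorff–Young inequality in bilinear form. -/
theorem enorm_integral_fourier_mul_le {q : ℝ≥0∞} (hq1 : 1 < q) (hq2 : q ≤ 2) {u v : ℝ → ℂ}
    (hum : Measurable u) (hvm : Measurable v) (hu : Integrable u) (hv : Integrable v)
    (huq : MemLp u q) (hvq : MemLp v q) :
    ‖∫ τ, 𝓕 u τ * v τ‖ₑ ≤ eLpNorm u q * eLpNorm v q := by
  have hqt : q ≠ ∞ := (hq2.trans_lt (by norm_num)).ne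
  have hq0 : q ≠ 0 := (zero_lt_one.trans hq1).ne'
  have hqr1 : 1 < q.toReal := by
    rw [← ENNReal.toReal_one, ENNReal.toReal_lt_toReal (by norm_num) hqt]; exact hq1
  have hqr2 : q.toReal ≤ 2 := by
    have := ENNReal.toReal_mono (by norm_num) hq2
    simpa using this
  set u' : ℕ → SimpleFunc ℝ ℂ := SimpleFunc.approxOn u hum (range u ∪ {0}) 0 (by simp) with hu'
  set v' : ℕ → SimpleFunc ℝ ℂ := SimpleFunc.approxOn v hvm (range v ∪ {0}) 0 (by simp) with hv'
  have hL1 : ∀ (w : ℝ → ℂ) (hw : Measurable w), Integrable w →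
      Tendsto (fun n => ∫ t, ‖SimpleFunc.approxOn w hw (range w ∪ {0}) 0 (by simp) n t - w t‖)
        atTop (𝓝 0) := by
    intro w hw hwi
    have h := SimpleFunc.tendsto_approxOn_range_L1_enorm hw hwi
    have h2 := (ENNReal.tendsto_toReal (by norm_num)).comp h
    simp only [ENNReal.toReal_zero] at h2
    refine h2.congr fun n => ?_
    rw [Function.comp_apply, integral_norm_eq_lintegral_enorm]
    exact ((SimpleFunc.aestronglyMeasurable _).sub hw.aestronglyMeasurable)
  have hi : ∀ (w : ℝ → ℂ) (hw : Measurable w), Integrable w →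
      ∀ n, Integrable (SimpleFunc.approxOn w hw (range w ∪ {0}) 0 (by simp) n) :=
    fun w hw hwi n => SimpleFunc.integrable_approxOn_range hw hwi n
  have hLq : ∀ (w : ℝ → ℂ) (hw : Measurable w), MemLp w q →
      Tendsto (fun n => eLpNorm (⇑(SimpleFunc.approxOn w hw (range w ∪ {0}) 0 (by simp) n) - w) q
        + eLpNorm w q) atTop (𝓝 (eLpNorm w q)) := by
    intro w hw hwq
    simpa using (SimpleFunc.tendsto_approxOn_range_Lp_eLpNorm hqt hw hwq.2).add_const
      (eLpNorm w q volume)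
  have hlim := (tendsto_integral_fourier_mul hu hv (hi u hum hu) (hi v hvm hv)
    (hL1 u hum hu) (hL1 v hvm hv)).enorm
  have hlim2 := ENNReal.Tendsto.mul (hLq u hum huq) (Or.inr hvq.2.ne) (hLq v hvm hvq)
    (Or.inr huq.2.ne)
  refine le_of_tendsto_of_tendsto' hlim hlim2 fun n => ?_
  have hle : ∀ (w : ℝ → ℂ) (hw : Measurable w), MemLp w q →
      eLpNorm (SimpleFunc.approxOn w hw (range w ∪ {0}) 0 (by simp) n) q ≤
      eLpNorm (⇑(SimpleFunc.approxOn w hw (range w ∪ {0}) 0 (by simp) n) - w) q + eLpNorm w q := by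
    intro w hw hwq
    have := eLpNorm_add_le (μ := volume) (p := q)
      ((SimpleFunc.approxOn w hw (range w ∪ {0}) 0 (by simp) n).aestronglyMeasurable.sub
        hw.aestronglyMeasurable) hw.aestronglyMeasurable hq1.le
    simpa using this
  refine le_trans ?_ (mul_le_mul' (hle u hum huq) (hle v hvm hvq))
  have hmu : MemLp (u' n) q volume := SimpleFunc.memLp_approxOn_range hum huq n
  have hmv : MemLp (v' n) q volume := SimpleFunc.memLp_approxOn_range hvm hvq n
  rw [hmu.eLpNorm_eq_integral_rpow_norm hq0 hqt, hmv.eLpNorm_eq_integral_rpow_norm hq0 hqt,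
    ← ENNReal.ofReal_mul (by positivity), ← ofReal_norm]
  refine ENNReal.ofReal_le_ofReal ?_
  simpa only [one_div] using norm_integral_fourier_mul_le_of_simpleFunc hqr1 hqr2 (u' n) (v' n)
    (hi u hum hu n) (hi v hvm hv n)

/-- Testing the bilinear inequality against `conj (𝓕 u) ‖𝓕 u‖ ^ (p - 2)`, cut off to a compact
interval. -/
theorem lintegral_Icc_enorm_fourier_rpow_le {p q : ℝ≥0∞} (hp : 2 ≤ p) (hpt : p ≠ ∞)
    (hpq : ENNReal.HolderConjugate p q) {u : ℝ → ℂ} (hum : Measurable u) (hu : Integrable u)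
    (huq : MemLp u q) (N : ℝ) :
    (∫⁻ τ in Icc (-N) N, ‖𝓕 u τ‖ₑ ^ p.toReal) ^ (1 / p.toReal) ≤ eLpNorm u q := by
  have hpr : 2 ≤ p.toReal := by
    simpa using ENNReal.toReal_mono hpt hp
  have hp1 : 1 < p.toReal := by linarith
  have hconj : p.toReal.HolderConjugate q.toReal := ENNReal.HolderConjugate.toReal hp1
  have hQ1 : 1 < q.toReal := hconj.symm.lt
  have hmul : p.toReal * q.toReal = p.toReal + q.toReal := hconj.mul_eq_add
  have hQ2 : q.toReal ≤ 2 := by nlinarith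
  have hqt : q ≠ ∞ := by
    rintro rfl
    simp at hQ1
    linarith
  have hq1 : 1 < q := by
    rw [← ENNReal.toReal_one, ENNReal.toReal_lt_toReal (by norm_num) hqt] at hQ1
    exact hQ1
  have hq2 : q ≤ 2 := by
    rw [← ENNReal.toReal_le_toReal hqt (by norm_num)]
    simpa using hQ2
  set F : ℝ → ℂ := 𝓕 u with hF
  have hFc : Continuous F := continuous_fourier hu
  set w : ℝ → ℂ := fun τ => (starRingEnd ℂ) (F τ) * ((‖F τ‖ ^ (p.toReal - 2) : ℝ) : ℂ) with hw
  have hwc : Continuous w := by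
    refine (Complex.continuous_conj.comp hFc).mul (Complex.continuous_ofReal.comp ?_)
    exact hFc.norm.rpow_const fun _ => Or.inr (by linarith)
  set s : Set ℝ := Icc (-N) N with hs
  have hsm : MeasurableSet s := measurableSet_Icc
  have hvL : ∀ r : ℝ≥0∞, MemLp (s.indicator w) r := by
    intro r
    rw [memLp_indicator_iff_restrict hsm]
    obtain ⟨C, hC⟩ := isCompact_Icc.exists_bound_of_continuousOn (hwc.continuousOn (s := s))
    have : IsFiniteMeasure (volume.restrict s) := ⟨by simp [hs]⟩
    exact MemLp.of_bound hwc.aestronglyMeasurable C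
      ((ae_restrict_iff' hsm).2 (Eventually.of_forall hC))
  have hFw : ∀ τ, F τ * w τ = ((‖F τ‖ ^ p.toReal : ℝ) : ℂ) := by
    intro τ
    rw [hw, ← mul_assoc, Complex.mul_conj, ← Complex.ofReal_mul, Complex.normSq_eq_norm_sq]
    congr 1
    rw [← Real.rpow_two, ← Real.rpow_add_of_nonneg (norm_nonneg _) (by norm_num) (by linarith)]
    congr 1
    ring
  have hwn : ∀ τ, ‖w τ‖ₑ ^ q.toReal = ‖F τ‖ₑ ^ p.toReal := by
    intro τ
    have : ‖w τ‖ = ‖F τ‖ ^ (p.toReal - 1) := by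
      rw [hw, norm_mul, RCLike.norm_conj, Complex.norm_real, Real.norm_of_nonneg (by positivity)]
      nth_rewrite 1 [← Real.rpow_one ‖F τ‖]
      rw [← Real.rpow_add_of_nonneg (norm_nonneg _) (by norm_num) (by linarith)]
      congr 1
      ring
    rw [← ofReal_norm, ← ofReal_norm, this,
      ENNReal.ofReal_rpow_of_nonneg (by positivity) (by linarith),
      ENNReal.ofReal_rpow_of_nonneg (by positivity) (by linarith), ← Real.rpow_mul (norm_nonneg _)]
    congr 2
    linarith
  set L : ℝ≥0∞ := ∫⁻ τ in s, ‖F τ‖ₑ ^ p.toReal with hL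
  have hvq : eLpNorm (s.indicator w) q = L ^ (1 / q.toReal) := by
    rw [eLpNorm_indicator_eq_eLpNorm_restrict hsm,
      eLpNorm_eq_lintegral_rpow_enorm_toReal (zero_lt_one.trans hq1).ne' hqt]
    simp_rw [hwn, hL]
  have hLt : L ≠ ∞ := by
    intro h
    have := (hvL q).2.ne
    rw [hvq, h, ENNReal.top_rpow_of_pos (by positivity)] at this
    exact this rfl
  have hpair : ‖∫ τ, F τ * s.indicator w τ‖ₑ = L := by
    have h1 : ∀ τ, F τ * s.indicator w τ =
        s.indicator (fun τ => ((‖F τ‖ ^ p.toReal : ℝ) : ℂ)) τ := by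
      intro τ
      by_cases h : τ ∈ s <;> simp only [indicator, h, if_true, if_false, mul_zero, hFw]
    simp_rw [h1]
    rw [integral_indicator hsm, integral_complex_ofReal, ← ofReal_norm, Complex.norm_real,
      Real.norm_of_nonneg (by positivity), integral_eq_lintegral_of_nonneg_ae
      (Eventually.of_forall fun τ => by positivity)
      (hFc.norm.rpow_const fun _ => Or.inr (by linarith)).aestronglyMeasurable, hL]
    have h2 : ∀ τ, ENNReal.ofReal (‖F τ‖ ^ p.toReal) = ‖F τ‖ₑ ^ p.toReal := fun τ => by
      rw [← ofReal_norm, ENNReal.ofReal_rpow_of_nonneg (norm_nonneg _) (by linarith)]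
    simp_rw [h2]
    exact ENNReal.ofReal_toReal hLt
  have hmain := enorm_integral_fourier_mul_le hq1 hq2 hum (hwc.measurable.indicator hsm) hu
    (memLp_one_iff_integrable.1 (hvL 1)) huq (hvL q)
  -- `L ≤ ‖u‖_q L ^ (1/q)` with `L` finite, so `L ^ (1/p)` may be isolated
  rw [hpair, hvq] at hmain
  rcases eq_or_ne L 0 with h0 | h0
  · rw [h0, ENNReal.zero_rpow_of_pos (by positivity)]
    exact zero_le
  · have hne : L ^ (1 / q.toReal) ≠ 0 := by simp [ENNReal.rpow_eq_zero_iff, h0, hLt]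
    have hnt : L ^ (1 / q.toReal) ≠ ∞ := ENNReal.rpow_ne_top_of_nonneg (by positivity) hLt
    rw [← ENNReal.mul_le_mul_iff_left hne hnt]
    refine le_trans (le_of_eq ?_) hmain
    rw [← ENNReal.rpow_add _ _ h0 hLt, hconj.one_div_add_one_div, div_one, ENNReal.rpow_one]

/-- The Hausdorff–Young inequality (with constant `1`) for functions in `L¹ ∩ L^q`. -/
theorem eLpNorm_fourier_le {p q : ℝ≥0∞} (hp : 2 ≤ p) (hpq : ENNReal.HolderConjugate p q)
    {u : ℝ → ℂ} (hum : Measurable u) (hu : Integrable u) (huq : MemLp u q) :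
    eLpNorm (𝓕 u) p ≤ eLpNorm u q := by
  by_cases hpt : p = ∞
  · subst hpt
    have hq : q = 1 := ENNReal.HolderConjugate.unique ∞ q 1 (hq' := .top_one)
    subst hq
    rw [eLpNorm_exponent_top, eLpNorm_one_eq_lintegral_enorm]
    refine eLpNormEssSup_le_of_ae_enorm_bound (Eventually.of_forall fun τ => ?_)
    rw [← ofReal_norm, ← ofReal_integral_norm_eq_lintegral_enorm hu]
    exact ENNReal.ofReal_le_ofReal (norm_fourier_le_integral_norm u τ)
  · have hp0 : p ≠ 0 := (lt_of_lt_of_le (by norm_num) hp).ne'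
    have hpr : 0 < p.toReal := ENNReal.toReal_pos hp0 hpt
    rw [eLpNorm_eq_lintegral_rpow_enorm_toReal hp0 hpt]
    have hcov : AECover volume atTop fun n : ℕ => Icc (-(n : ℝ)) n :=
      aecover_Icc (tendsto_neg_atTop_atBot.comp tendsto_natCast_atTop_atTop)
        tendsto_natCast_atTop_atTop
    have hlim := hcov.lintegral_tendsto_of_countably_generated
      (f := fun τ => ‖𝓕 u τ‖ₑ ^ p.toReal)
      ((continuous_fourier hu).measurable.enorm.pow_const _).aemeasurable
    refine le_of_tendsto' (((ENNReal.continuous_rpow_const (y := 1 / p.toReal)).tendsto _).comp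
      hlim) fun n => ?_
    exact lintegral_Icc_enorm_fourier_rpow_le hp hpt hpq hum hu huq n

theorem integral_exp_mul_eq_fourier (h : ℝ → ℂ) (τ : ℝ) :
    ∫ t : ℝ, Complex.exp (Complex.I * τ * t) * h t = 𝓕 h (-(2 * Real.pi)⁻¹ * τ) := by
  rw [Real.fourier_eq]
  congr 1 with t
  rw [Circle.smul_def, smul_eq_mul, Real.fourierChar_apply]
  congr 2
  have : (Real.pi : ℂ) ≠ 0 := by exact_mod_cast Real.pi_ne_zero
  simp only [RCLike.inner_apply, conj_trivial]
  push_cast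
  field_simp

theorem continuous_integral_exp_mul {h : ℝ → ℂ} (hh : Integrable h) :
    Continuous fun τ : ℝ => ∫ t : ℝ, Complex.exp (Complex.I * τ * t) * h t := by
  simp_rw [integral_exp_mul_eq_fourier]
  exact (continuous_fourier hh).comp (continuous_const.mul continuous_id)

/-- The Hausdorff–Young inequality for the Fourier integral with kernel `e ^ (i τ t)`. -/
theorem eLpNorm_integral_exp_mul_le {p q : ℝ≥0∞} (hp : 2 ≤ p) (hpq : ENNReal.HolderConjugate p q)
    {h : ℝ → ℂ} (hm : Measurable h) (hh : Integrable h) (hq : MemLp h q) :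
    eLpNorm (fun τ : ℝ => ∫ t : ℝ, Complex.exp (Complex.I * τ * t) * h t) p ≤
      ENNReal.ofReal ((2 * Real.pi) ^ (1 / p.toReal)) * eLpNorm h q := by
  have hc : -(2 * Real.pi)⁻¹ ≠ 0 := by
    have := Real.pi_pos
    simp [this.ne']
  have hpi : (0 : ℝ) < 2 * Real.pi := by positivity
  have habs : |(-(2 * Real.pi)⁻¹)⁻¹| = 2 * Real.pi := by
    rw [inv_neg, inv_inv, abs_neg, abs_of_pos hpi]
  have hmap := eLpNorm_map_measure (p := p) (μ := volume) (f := fun τ => -(2 * Real.pi)⁻¹ * τ)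
    (g := 𝓕 h) (continuous_fourier hh).aestronglyMeasurable (by fun_prop)
  rw [Real.map_volume_mul_left hc, habs, eLpNorm_smul_measure_of_ne_zero (by simpa using hpi)]
    at hmap
  have hexp : ENNReal.ofReal ((2 * Real.pi) ^ (1 / p.toReal)) =
      ENNReal.ofReal (2 * Real.pi) ^ (1 / p).toReal := by
    rw [ENNReal.ofReal_rpow_of_pos hpi, one_div, one_div, ENNReal.toReal_inv]
  simp_rw [integral_exp_mul_eq_fourier]
  change eLpNorm (𝓕 h ∘ _) p volume ≤ _
  rw [← hmap, hexp, smul_eq_mul]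
  gcongr
  exact eLpNorm_fourier_le hp hpq hm hh hq

end HausdorffYoung

/-! ### A beta integral -/

theorem lintegral_Ioo_rpow_mul_rpow {a b : ℝ} (ha : 0 < a) (hb : 0 < b) :
    ∫⁻ x in Ioo (0 : ℝ) 1, ENNReal.ofReal (x ^ (a - 1) * (1 - x) ^ (b - 1)) =
      ENNReal.ofReal (ProbabilityTheory.beta a b) := by
  have hB := ProbabilityTheory.beta_pos ha hb
  have h := ProbabilityTheory.lintegral_betaPDF_eq_one ha hb
  rw [ProbabilityTheory.lintegral_betaPDF] at h
  simp_rw [mul_assoc, ENNReal.ofReal_mul (one_div_nonneg.2 hB.le)] at h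
  rw [lintegral_const_mul' _ _ ENNReal.ofReal_ne_top, one_div, ENNReal.ofReal_inv_of_pos hB,
    mul_comm] at h
  rw [ENNReal.eq_inv_of_mul_eq_one_left h, inv_inv]

/-- The substitution `x = 1 / (1 + e ^ (-2u)) = e ^ u / (2 cosh u)` in the beta integral. -/
theorem lintegral_exp_mul_cosh_rpow {α β : ℝ} (hα : |α| < β) :
    ∫⁻ u : ℝ, ENNReal.ofReal (Real.exp (α * u) * Real.cosh u ^ (-β)) =
      ENNReal.ofReal (2 ^ (β - 1) * ProbabilityTheory.beta ((β + α) / 2) ((β - α) / 2)) := by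
  obtain ⟨h1, h2⟩ := abs_lt.1 hα
  have ha : 0 < (β + α) / 2 := by linarith
  have hb : 0 < (β - α) / 2 := by linarith
  set f : ℝ → ℝ := fun u => Real.sigmoid (2 * u) with hf
  have hd : ∀ u ∈ (univ : Set ℝ), HasDerivWithinAt f
      (Real.sigmoid (2 * u) * (1 - Real.sigmoid (2 * u)) * 2) univ u := by
    intro u _
    refine HasDerivAt.hasDerivWithinAt ?_
    have := (Real.hasDerivAt_sigmoid (2 * u)).comp u ((hasDerivAt_id u).const_mul 2)
    rw [mul_one] at this
    exact this
  have hinj : InjOn f univ := fun u _ v _ huv => by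
    have := Real.sigmoid_injective huv
    linarith
  have himg : f '' univ = Ioo 0 1 := by
    rw [image_univ, ← Real.range_sigmoid]
    exact (mul_left_surjective₀ (two_ne_zero (α := ℝ))).range_comp Real.sigmoid
  have hsub := lintegral_image_eq_lintegral_abs_deriv_mul MeasurableSet.univ hd hinj
    (fun x => ENNReal.ofReal (x ^ ((β + α) / 2 - 1) * (1 - x) ^ ((β - α) / 2 - 1)))
  rw [himg, lintegral_Ioo_rpow_mul_rpow ha hb, setLIntegral_univ] at hsub
  have hpt : ∀ u : ℝ, ENNReal.ofReal (Real.exp (α * u) * Real.cosh u ^ (-β)) =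
      ENNReal.ofReal (2 ^ (β - 1)) *
      (ENNReal.ofReal |Real.sigmoid (2 * u) * (1 - Real.sigmoid (2 * u)) * 2| *
        ENNReal.ofReal (f u ^ ((β + α) / 2 - 1) * (1 - f u) ^ ((β - α) / 2 - 1))) := by
    intro u
    have hc : 0 < Real.cosh u := Real.cosh_pos u
    have hs : Real.sigmoid (2 * u) = Real.exp u * (2 * Real.cosh u)⁻¹ := by
      rw [Real.sigmoid_def, Real.cosh_eq, show -(2 * u) = -u + -u by ring, Real.exp_add,
        Real.exp_neg]
      have := Real.exp_pos u
      field_simp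
    have hs' : 1 - Real.sigmoid (2 * u) = Real.exp (-u) * (2 * Real.cosh u)⁻¹ := by
      rw [hs, Real.cosh_eq]
      have := Real.exp_pos u
      have := Real.exp_pos (-u)
      field_simp
      ring
    have hp1 := Real.sigmoid_pos (2 * u)
    have hp2 : 0 < 1 - Real.sigmoid (2 * u) := sub_pos.2 (Real.sigmoid_lt_one _)
    rw [← ENNReal.ofReal_mul (abs_nonneg _), ← ENNReal.ofReal_mul (by positivity),
      abs_of_pos (by positivity)]
    congr 1
    have e1 : ∀ {y : ℝ} (_ : 0 < y) (c : ℝ), y * y ^ (c - 1) = y ^ c := by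
      intro y hy c
      rw [Real.rpow_sub_one hy.ne']
      field_simp
    calc Real.exp (α * u) * Real.cosh u ^ (-β)
        = 2 ^ (β - 1) * 2 * (Real.sigmoid (2 * u) ^ ((β + α) / 2) *
            (1 - Real.sigmoid (2 * u)) ^ ((β - α) / 2)) := by
          rw [hs', hs, Real.mul_rpow (by positivity) (by positivity),
            Real.mul_rpow (by positivity) (by positivity), ← Real.exp_mul, ← Real.exp_mul]
          have e2 : ((2 * Real.cosh u)⁻¹ : ℝ) ^ ((β + α) / 2) *
              ((2 * Real.cosh u)⁻¹) ^ ((β - α) / 2) = 2 ^ (-β) * Real.cosh u ^ (-β) := by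
            rw [← Real.rpow_add (by positivity), Real.inv_rpow (by positivity),
              ← Real.rpow_neg (by positivity), Real.mul_rpow (by norm_num) hc.le]
            ring_nf
          have e3 : Real.exp (u * ((β + α) / 2)) * Real.exp (-u * ((β - α) / 2)) =
              Real.exp (α * u) := by
            rw [← Real.exp_add]; ring_nf
          have e4 : (2 : ℝ) ^ (β - 1) * 2 * 2 ^ (-β) = 1 := by
            rw [Real.rpow_sub_one two_ne_zero, Real.rpow_neg (by norm_num)]
            field_simp
          calc _ = (2 ^ (β - 1) * 2 * 2 ^ (-β)) * (Real.exp (α * u) * Real.cosh u ^ (-β)) := by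
                rw [e4, one_mul]
            _ = 2 ^ (β - 1) * 2 * ((Real.exp (u * ((β + α) / 2)) *
                  Real.exp (-u * ((β - α) / 2))) * (2 ^ (-β) * Real.cosh u ^ (-β))) := by
                rw [e3]; ring
            _ = _ := by rw [← e2]; ring
      _ = _ := by
          rw [← e1 hp1 ((β + α) / 2), ← e1 hp2 ((β - α) / 2)]
          simp only [hf]
          ring
  simp_rw [hpt]
  rw [lintegral_const_mul' _ _ ENNReal.ofReal_ne_top, ← hsub, ← ENNReal.ofReal_mul (by positivity)]

/-! ### The weighted spaces and Hölder's inequality -/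

/-- The multiplicatively invariant measure `dx / x` on `(0, ∞)`. -/
noncomputable def mulHaar : Measure ℝ :=
  (volume.restrict (Ioi 0)).withDensity fun x => ENNReal.ofReal x⁻¹

theorem lintegral_mulHaar (g : ℝ → ℝ≥0∞) :
    ∫⁻ x, g x ∂mulHaar = ∫⁻ x in Ioi (0 : ℝ), ENNReal.ofReal x⁻¹ * g x := by
  rw [mulHaar, lintegral_withDensity_eq_lintegral_mul_non_measurable _ (by fun_prop)
    (Filter.Eventually.of_forall fun _ => ENNReal.ofReal_lt_top)]
  rfl

theorem mulHaar_absolutelyContinuous : mulHaar ≪ volume.restrict (Ioi 0) :=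
  withDensity_absolutelyContinuous _ _

theorem absolutelyContinuous_mulHaar : volume.restrict (Ioi 0) ≪ mulHaar := by
  refine withDensity_absolutelyContinuous' (by fun_prop) ?_
  filter_upwards [ae_restrict_mem measurableSet_Ioi] with x hx
  simpa using hx

/-- The norm of `L_{ν,p}` is the `L^p` norm of `x ^ ν f(x)` with respect to `dx / x`. -/
theorem weightedNorm_eq_eLpNorm (ν : ℝ) {p : ℝ≥0∞} (hp : p ≠ 0) (f : ℝ → ℂ) :
    weightedNorm ν p f = eLpNorm (fun x => x ^ ν • f x) p mulHaar := by
  have hen : ∀ x ∈ Ioi (0 : ℝ), ‖x ^ ν • f x‖ₑ = ENNReal.ofReal (x ^ ν) * ‖f x‖ₑ := by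
    intro x hx
    rw [enorm_smul, Real.enorm_of_nonneg (Real.rpow_nonneg (le_of_lt hx) _)]
  unfold weightedNorm
  split_ifs with h
  · subst h
    rw [eLpNorm_exponent_top, eLpNormEssSup]
    have hae : (fun x => ‖x ^ ν • f x‖ₑ) =ᵐ[volume.restrict (Ioi 0)]
        fun x => ENNReal.ofReal (x ^ ν) * ‖f x‖ₑ := by
      filter_upwards [ae_restrict_mem measurableSet_Ioi] with x hx using hen x hx
    rw [← essSup_congr_ae hae]
    exact le_antisymm (essSup_mono_measure absolutelyContinuous_mulHaar)
      (essSup_mono_measure mulHaar_absolutelyContinuous)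
  · rw [eLpNorm_eq_lintegral_rpow_enorm_toReal hp h, lintegral_mulHaar]
    congr 1
    refine setLIntegral_congr_fun measurableSet_Ioi fun x hx => ?_
    have hx0 : 0 < x := hx
    rw [hen x hx, ENNReal.mul_rpow_of_nonneg _ _ ENNReal.toReal_nonneg,
      ENNReal.ofReal_rpow_of_pos (Real.rpow_pos_of_pos hx0 _), ← mul_assoc,
      ← ENNReal.ofReal_mul (by positivity), ← Real.rpow_mul hx0.le, Real.rpow_sub_one hx0.ne',
      div_eq_inv_mul]

theorem lintegral_rpow_mul_exp_neg_mul {a r : ℝ} (ha : 0 < a) (hr : 0 < r) :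
    ∫⁻ x in Ioi (0 : ℝ), ENNReal.ofReal (x ^ (a - 1) * Real.exp (-(r * x))) =
      ENNReal.ofReal ((1 / r) ^ a * Real.Gamma a) := by
  rw [← Real.integral_rpow_mul_exp_neg_mul_Ioi ha hr, ofReal_integral_eq_lintegral_ofReal]
  · refine (Integrable.of_integral_ne_zero ?_)
    rw [Real.integral_rpow_mul_exp_neg_mul_Ioi ha hr]
    have := Real.Gamma_pos_of_pos ha
    positivity
  · filter_upwards [ae_restrict_mem measurableSet_Ioi] with x hx
    have : 0 < x := hx
    positivity

/-- Hölder's inequality with respect to `dx / x`, applied to `x ^ β e ^ (-r x)` and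
`x ^ (1 - β) f(x)`. -/
theorem lintegral_exp_neg_mul_enorm_le {β : ℝ} (hβ : 0 < β) {p q : ℝ≥0∞} (hp : p ≠ 0)
    (hq0 : q ≠ 0) (hqt : q ≠ ∞) (hpq : ENNReal.HolderConjugate p q) {r : ℝ} (hr : 0 < r)
    {f : ℝ → ℂ} (hf : AEStronglyMeasurable f (volume.restrict (Ioi 0))) :
    ∫⁻ x in Ioi (0 : ℝ), ENNReal.ofReal (Real.exp (-(r * x))) * ‖f x‖ₑ ≤
      ENNReal.ofReal (Real.Gamma (q.toReal * β) ^ (1 / q.toReal) * (q.toReal * r) ^ (-β)) *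
        weightedNorm (1 - β) p f := by
  have hQ : 0 < q.toReal := ENNReal.toReal_pos hq0 hqt
  have hf' : AEStronglyMeasurable f mulHaar := hf.mono_ac mulHaar_absolutelyContinuous
  set g : ℝ → ℝ := fun x => x ^ β * Real.exp (-(r * x)) with hg
  have hgm : Measurable g := by fun_prop
  have hfm : AEStronglyMeasurable (fun x : ℝ => x ^ (1 - β) • f x) mulHaar :=
    (by fun_prop : Measurable fun x : ℝ => x ^ (1 - β)).aestronglyMeasurable.smul hf'
  have hpq' := hpq.symm
  have hH := eLpNorm_smul_le_mul_eLpNorm (p := q) (q := p) (r := 1) hfm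
    (hgm.aestronglyMeasurable (μ := mulHaar))
  have hleft : eLpNorm (g • fun x : ℝ => x ^ (1 - β) • f x) 1 mulHaar =
      ∫⁻ x in Ioi (0 : ℝ), ENNReal.ofReal (Real.exp (-(r * x))) * ‖f x‖ₑ := by
    rw [eLpNorm_one_eq_lintegral_enorm, lintegral_mulHaar]
    refine setLIntegral_congr_fun measurableSet_Ioi fun x hx => ?_
    have hx0 : 0 < x := hx
    simp only [Pi.smul_apply', hg]
    rw [enorm_smul, enorm_smul, Real.enorm_of_nonneg (by positivity),
      Real.enorm_of_nonneg (by positivity), ← mul_assoc, ← mul_assoc,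
      ← ENNReal.ofReal_mul (by positivity), ← ENNReal.ofReal_mul (by positivity)]
    congr 2
    have : x ^ β * x ^ (1 - β) = x := by
      rw [← Real.rpow_add hx0]; simp
    calc x⁻¹ * (x ^ β * Real.exp (-(r * x))) * x ^ (1 - β)
        = x⁻¹ * (x ^ β * x ^ (1 - β)) * Real.exp (-(r * x)) := by ring
      _ = _ := by rw [this, inv_mul_cancel₀ hx0.ne', one_mul]
  have hright : eLpNorm g q mulHaar =
      ENNReal.ofReal (Real.Gamma (q.toReal * β) ^ (1 / q.toReal) * (q.toReal * r) ^ (-β)) := by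
    rw [eLpNorm_eq_lintegral_rpow_enorm_toReal hq0 hqt, lintegral_mulHaar]
    have hint : ∫⁻ x in Ioi (0 : ℝ), ENNReal.ofReal x⁻¹ * ‖g x‖ₑ ^ q.toReal =
        ∫⁻ x in Ioi (0 : ℝ), ENNReal.ofReal
          (x ^ (q.toReal * β - 1) * Real.exp (-(q.toReal * r * x))) := by
      refine setLIntegral_congr_fun measurableSet_Ioi fun x hx => ?_
      have hx0 : 0 < x := hx
      simp only [hg]
      rw [Real.enorm_of_nonneg (by positivity), ENNReal.ofReal_rpow_of_pos (by positivity),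
        ← ENNReal.ofReal_mul (by positivity), Real.mul_rpow (by positivity) (by positivity),
        ← Real.rpow_mul hx0.le, ← Real.exp_mul, Real.rpow_sub_one hx0.ne']
      congr 1
      rw [mul_comm β, show -(r * x) * q.toReal = -(q.toReal * r * x) by ring]
      ring
    have hG := Real.Gamma_pos_of_pos (mul_pos hQ hβ)
    rw [hint, lintegral_rpow_mul_exp_neg_mul (by positivity) (by positivity),
      ENNReal.ofReal_rpow_of_pos (by positivity), Real.mul_rpow (by positivity) hG.le,
      ← Real.rpow_mul (by positivity), one_div (q.toReal * r), Real.inv_rpow (by positivity),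
      ← Real.rpow_neg (by positivity), mul_comm]
    congr 4
    field_simp
  rw [hleft, hright] at hH
  rwa [weightedNorm_eq_eLpNorm _ hp]

/-! ### The product formula for Macdonald functions -/

/-- The integrand `e ^ (-x cosh u) e ^ (μ u)` of the Macdonald function as an integral over the
whole line. -/
noncomputable def macdonaldIntegrand (μ : ℂ) (x u : ℝ) : ℂ :=
  Real.exp (-(x * Real.cosh u)) * Complex.exp (μ * u)

/-- The Macdonald function of real order and positive real argument, as an integral over the whole
line. -/
noncomputable def macdonaldReal (α y : ℝ) : ℝ :=
  1 / 2 * ∫ s : ℝ, Real.exp (-(y * Real.cosh s)) * Real.exp (α * s)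

theorem integrable_exp_neg_cosh_mul_exp (α : ℝ) {y : ℝ} (hy : 0 < y) :
    Integrable fun s : ℝ => Real.exp (-(y * Real.cosh s)) * Real.exp (α * s) := by
  -- the beta integral gives convergence once `e ^ (-y cosh s)` is bounded by a power of `cosh s`
  obtain ⟨n, hn⟩ := exists_nat_gt |α|
  have hfin : Integrable fun s : ℝ => Real.exp (α * s) * Real.cosh s ^ (-(n : ℝ)) := by
    have hc : Continuous fun s : ℝ => Real.exp (α * s) * Real.cosh s ^ (-(n : ℝ)) :=
      (by fun_prop : Continuous fun s : ℝ => Real.exp (α * s)).mul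
        (Real.continuous_cosh.rpow_const fun s => Or.inl (Real.cosh_pos s).ne')
    refine (lintegral_ofReal_ne_top_iff_integrable hc.aestronglyMeasurable
      (Filter.Eventually.of_forall fun s => ?_)).1 ?_
    · have := Real.cosh_pos s
      simp only [Pi.zero_apply]
      positivity
    · rw [lintegral_exp_mul_cosh_rpow hn]
      exact ENNReal.ofReal_ne_top
  refine (hfin.const_mul (n.factorial / y ^ n)).mono' (by fun_prop)
    (Filter.Eventually.of_forall fun s => ?_)
  have hcs := Real.cosh_pos s
  -- `e ^ (-t) ≤ n! / t ^ n` with `t = y cosh s`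
  have h := Real.pow_div_factorial_le_exp (y * Real.cosh s) (by positivity) n
  have h2 : Real.exp (-(y * Real.cosh s)) ≤ n.factorial / y ^ n * Real.cosh s ^ (-(n : ℝ)) := by
    rw [Real.exp_neg, Real.rpow_neg hcs.le, Real.rpow_natCast]
    refine (inv_anti₀ (by positivity) h).trans_eq ?_
    rw [mul_pow]
    field_simp
  rw [Real.norm_of_nonneg (by positivity)]
  calc _ ≤ n.factorial / y ^ n * Real.cosh s ^ (-(n : ℝ)) * Real.exp (α * s) := by gcongr
    _ = _ := by ring

theorem norm_macdonaldIntegrand (μ : ℂ) (x u : ℝ) :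
    ‖macdonaldIntegrand μ x u‖ = Real.exp (-(x * Real.cosh u)) * Real.exp (μ.re * u) := by
  rw [macdonaldIntegrand, norm_mul, Complex.norm_real, Real.norm_of_nonneg (Real.exp_pos _).le,
    Complex.norm_exp]
  simp

theorem integrable_macdonaldIntegrand (μ : ℂ) {x : ℝ} (hx : 0 < x) :
    Integrable (macdonaldIntegrand μ x) := by
  refine (integrable_exp_neg_cosh_mul_exp μ.re hx).mono' ?_
    (Filter.Eventually.of_forall fun u => (norm_macdonaldIntegrand μ x u).le)
  unfold macdonaldIntegrand
  fun_prop

theorem macdonald_eq_integral (μ : ℂ) {x : ℝ} (hx : 0 < x) :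
    macdonald μ x = 1 / 2 * ∫ u, macdonaldIntegrand μ x u := by
  have hi := integrable_macdonaldIntegrand μ hx
  have hsplit : ∫ u, macdonaldIntegrand μ x u =
      ∫ u in Ioi (0 : ℝ), (macdonaldIntegrand μ x (-u) + macdonaldIntegrand μ x u) := by
    rw [integral_add hi.comp_neg.integrableOn hi.integrableOn,
      integral_comp_neg_Ioi, neg_zero, intervalIntegral.integral_Iic_add_Ioi hi.integrableOn
      hi.integrableOn]
  rw [hsplit, ← integral_const_mul, macdonald]
  congr 1 with u
  simp only [macdonaldIntegrand, Real.cosh_neg]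
  rw [Complex.cosh.eq_1 (μ * u)]
  push_cast
  rw [mul_neg, neg_mul]
  ring

theorem conj_macdonald (μ : ℂ) {x : ℝ} (hx : 0 < x) :
    (starRingEnd ℂ) (macdonald μ x) = macdonald ((starRingEnd ℂ) μ) x := by
  rw [macdonald_eq_integral _ hx, macdonald_eq_integral _ hx, map_mul, ← integral_conj]
  congr 1
  · simp [map_ofNat]
  · congr 1 with u
    rw [macdonaldIntegrand, macdonaldIntegrand, map_mul, Complex.conj_ofReal, ← Complex.exp_conj,
      map_mul, Complex.conj_ofReal]

/-- Change of variables `u = s + t`, `v = s - t` in a product of two integrals over the line. -/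
theorem integral_mul_integral_eq {g k : ℝ → ℂ} (hg : Integrable g) (hk : Integrable k) :
    (∫ u, g u) * ∫ v, k v = 2 * ∫ t : ℝ, ∫ s : ℝ, g (s + t) * k (s - t) := by
  have hM : Integrable (fun z : ℝ × ℝ => g z.2 * k z.1) (volume.prod volume) := by
    simpa only [mul_comm] using hk.mul_prod hg
  have hsh := measurePreserving_prod_add (volume : Measure ℝ) (volume : Measure ℝ)
  have hM' : Integrable (fun z : ℝ × ℝ => g (z.1 + z.2) * k z.1) (volume.prod volume) :=
    (hsh.integrable_comp hM.aestronglyMeasurable).2 hM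
  calc (∫ u, g u) * ∫ v, k v = ∫ v, ∫ u, g u * k v := by
        simp_rw [integral_mul_const, integral_const_mul]
    _ = ∫ v, ∫ w, g (v + w) * k v := by
        congr 1 with v
        rw [integral_add_left_eq_self (fun u => g u * k v) v]
    _ = ∫ w, ∫ v, g (v + w) * k v := integral_integral_swap hM'
    _ = 2 * ∫ t : ℝ, ∫ v, g (v + 2 * t) * k v := by
        rw [Measure.integral_comp_mul_left (fun w => ∫ v, g (v + w) * k v) 2]
        simp
    _ = _ := by
        congr 2 with t
        rw [← integral_sub_right_eq_self (fun v => g (v + 2 * t) * k v) t]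
        congr 1 with s
        ring_nf

/-- The product formula for Macdonald functions:
`|K_{(iτ+α)/2}(x)|² = ∫_ℝ e ^ (iτt) K_α(2x cosh t) dt`. -/
theorem lebedevKernel_eq_integral (α τ : ℝ) {x : ℝ} (hx : 0 < x) :
    (lebedevKernel α τ x : ℂ) =
      ∫ t : ℝ, Complex.exp (Complex.I * τ * t) * macdonaldReal α (2 * x * Real.cosh t) := by
  set μ : ℂ := (Complex.I * τ + α) / 2 with hμ
  have h1 : (lebedevKernel α τ x : ℂ) = macdonald μ x * macdonald ((starRingEnd ℂ) μ) x := by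
    rw [lebedevKernel, ← conj_macdonald _ hx, Complex.mul_conj, Complex.normSq_eq_norm_sq]
  rw [h1, macdonald_eq_integral _ hx, macdonald_eq_integral _ hx,
    show ∀ a b : ℂ, 1 / 2 * a * (1 / 2 * b) = 1 / 4 * (a * b) from fun a b => by ring,
    integral_mul_integral_eq (integrable_macdonaldIntegrand _ hx)
      (integrable_macdonaldIntegrand _ hx), ← mul_assoc, ← integral_const_mul]
  congr 1 with t
  rw [macdonaldReal]
  push_cast
  rw [← integral_complex_ofReal, mul_left_comm, ← integral_const_mul, ← integral_const_mul,
    ← integral_const_mul]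
  congr 1 with s
  have hcosh : Real.cosh (s + t) + Real.cosh (s - t) = 2 * (Real.cosh s * Real.cosh t) := by
    rw [Real.cosh_add, Real.cosh_sub]; ring
  have hexp1 : Real.exp (-(x * Real.cosh (s + t))) * Real.exp (-(x * Real.cosh (s - t))) =
      Real.exp (-(2 * x * Real.cosh t * Real.cosh s)) := by
    rw [← Real.exp_add, ← neg_add, ← mul_add, hcosh]; ring_nf
  have hμc : (starRingEnd ℂ) μ = (-(Complex.I * τ) + α) / 2 := by
    simp [hμ, map_ofNat]
  have hexp2 : Complex.exp (μ * (s + t : ℝ)) * Complex.exp ((starRingEnd ℂ) μ * (s - t : ℝ)) =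
      Complex.exp (Complex.I * τ * t) * (Real.exp (α * s) : ℝ) := by
    rw [Complex.ofReal_exp, ← Complex.exp_add, ← Complex.exp_add, hμc, hμ]
    push_cast
    ring_nf
  simp only [macdonaldIntegrand]
  rw [Complex.ofReal_mul, ← hexp1, Complex.ofReal_mul]
  calc _ = 1 / 2 * ((Real.exp (-(x * Real.cosh (s + t))) : ℂ) *
        (Real.exp (-(x * Real.cosh (s - t))) : ℂ) *
        (Complex.exp (μ * (s + t : ℝ)) * Complex.exp ((starRingEnd ℂ) μ * (s - t : ℝ)))) := by
          ring
    _ = _ := by rw [hexp2]; ring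

/-! ### The index transform as a Fourier integral -/

theorem macdonaldReal_nonneg (α y : ℝ) : 0 ≤ macdonaldReal α y := by
  unfold macdonaldReal
  positivity

theorem measurable_macdonaldReal (α : ℝ) : Measurable (macdonaldReal α) := by
  have h : StronglyMeasurable fun z : ℝ × ℝ =>
      Real.exp (-(z.1 * Real.cosh z.2)) * Real.exp (α * z.2) :=
    (by fun_prop : Continuous fun z : ℝ × ℝ =>
      Real.exp (-(z.1 * Real.cosh z.2)) * Real.exp (α * z.2)).stronglyMeasurable
  exact (h.integral_prod_right (ν := volume)).measurable.const_mul _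

theorem enorm_macdonaldReal (α : ℝ) {y : ℝ} (hy : 0 < y) :
    ‖macdonaldReal α y‖ₑ =
      ENNReal.ofReal (1 / 2) * ∫⁻ s : ℝ, ENNReal.ofReal (Real.exp (α * s)) *
        ENNReal.ofReal (Real.exp (-(y * Real.cosh s))) := by
  rw [Real.enorm_of_nonneg (macdonaldReal_nonneg α y), macdonaldReal,
    ENNReal.ofReal_mul (by norm_num), ofReal_integral_eq_lintegral_ofReal
    (integrable_exp_neg_cosh_mul_exp α hy) (Filter.Eventually.of_forall fun s => by positivity)]
  congr 2 with s
  rw [← ENNReal.ofReal_mul (by positivity), mul_comm]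

/-- The constant `C` in `∫₀^∞ K_α(2x cosh t) |f(x)| dx ≤ C (cosh t) ^ (-β) ‖f‖_{1-β,p}`, where `Q` is
the exponent conjugate to `p`. -/
noncomputable def transferConst (α β Q : ℝ) : ℝ :=
  Real.Gamma (Q * β) ^ (1 / Q) * (2 * Q) ^ (-β) *
    (2 ^ (β - 2) * ProbabilityTheory.beta ((β + α) / 2) ((β - α) / 2))

theorem transferConst_nonneg {α β Q : ℝ} (hα : |α| < β) (hQ : 0 < Q) :
    0 ≤ transferConst α β Q := by
  obtain ⟨h1, h2⟩ := abs_lt.1 hα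
  have hβ : 0 < β := by linarith
  have := Real.Gamma_pos_of_pos (mul_pos hQ hβ)
  have := ProbabilityTheory.beta_pos (α := (β + α) / 2) (β := (β - α) / 2) (by linarith)
    (by linarith)
  unfold transferConst
  positivity

/-- Tonelli's theorem, Hölder's inequality for each fixed `s` in the integral representation of
`K_α`, and the beta integral in `s`. -/
theorem lintegral_macdonaldReal_mul_le {α β : ℝ} (hα : |α| < β) {p q : ℝ≥0∞} (hp : p ≠ 0)
    (hq0 : q ≠ 0) (hqt : q ≠ ∞) (hpq : ENNReal.HolderConjugate p q) {f : ℝ → ℂ}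
    (hf : AEStronglyMeasurable f (volume.restrict (Ioi 0))) (t : ℝ) :
    ∫⁻ x in Ioi (0 : ℝ), ‖macdonaldReal α (2 * x * Real.cosh t)‖ₑ * ‖f x‖ₑ ≤
      ENNReal.ofReal (transferConst α β q.toReal * Real.cosh t ^ (-β)) *
        weightedNorm (1 - β) p f := by
  have hβ : 0 < β := (abs_nonneg α).trans_lt hα
  have hQ : 0 < q.toReal := ENNReal.toReal_pos hq0 hqt
  have hct := Real.cosh_pos t
  have hG := Real.Gamma_pos_of_pos (mul_pos hQ hβ)
  set W := weightedNorm (1 - β) p f with hW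
  calc ∫⁻ x in Ioi (0 : ℝ), ‖macdonaldReal α (2 * x * Real.cosh t)‖ₑ * ‖f x‖ₑ
      = ∫⁻ x in Ioi (0 : ℝ), ENNReal.ofReal (1 / 2) * ∫⁻ s : ℝ,
          ENNReal.ofReal (Real.exp (α * s)) *
          (ENNReal.ofReal (Real.exp (-(2 * Real.cosh t * Real.cosh s * x))) * ‖f x‖ₑ) := by
        refine setLIntegral_congr_fun measurableSet_Ioi fun x hx => ?_
        have hx0 : 0 < x := hx
        rw [enorm_macdonaldReal α (by positivity), mul_assoc, ← lintegral_mul_const' _ _ (by simp)]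
        congr 2 with s
        rw [mul_assoc]
        congr 5
        ring
    _ = ENNReal.ofReal (1 / 2) * ∫⁻ s : ℝ, ∫⁻ x in Ioi (0 : ℝ),
          ENNReal.ofReal (Real.exp (α * s)) *
          (ENNReal.ofReal (Real.exp (-(2 * Real.cosh t * Real.cosh s * x))) * ‖f x‖ₑ) := by
        rw [lintegral_const_mul' _ _ ENNReal.ofReal_ne_top, lintegral_lintegral_swap]
        have h1 : AEMeasurable (fun z : ℝ × ℝ => ‖f z.1‖ₑ)
            ((volume.restrict (Ioi 0)).prod volume) := hf.enorm.comp_fst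
        refine AEMeasurable.mul (by fun_prop) (AEMeasurable.mul (by fun_prop) h1)
    _ ≤ ENNReal.ofReal (1 / 2) * ∫⁻ s : ℝ,
          ENNReal.ofReal (Real.exp (α * s) * Real.cosh s ^ (-β)) *
          (ENNReal.ofReal (Real.Gamma (q.toReal * β) ^ (1 / q.toReal) * (2 * q.toReal) ^ (-β) *
            Real.cosh t ^ (-β)) * W) := by
        gcongr with s
        have hcs := Real.cosh_pos s
        rw [lintegral_const_mul' _ _ ENNReal.ofReal_ne_top]
        refine (mul_le_mul_right (lintegral_exp_neg_mul_enorm_le hβ hp hq0 hqt hpq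
          (r := 2 * Real.cosh t * Real.cosh s) (by positivity) hf) _).trans_eq ?_
        rw [← hW, ← mul_assoc (ENNReal.ofReal _) (ENNReal.ofReal _) W,
          ← mul_assoc (ENNReal.ofReal _) (ENNReal.ofReal _) W, ← ENNReal.ofReal_mul (by positivity),
          ← ENNReal.ofReal_mul (by positivity)]
        congr 2
        rw [show q.toReal * (2 * Real.cosh t * Real.cosh s) =
          2 * q.toReal * Real.cosh t * Real.cosh s by ring,
          Real.mul_rpow (by positivity) hcs.le, Real.mul_rpow (by positivity) hct.le]
        ring
    _ = _ := by
        obtain ⟨h1, h2⟩ := abs_lt.1 hα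
        have hB := ProbabilityTheory.beta_pos (α := (β + α) / 2) (β := (β - α) / 2) (by linarith)
          (by linarith)
        rw [lintegral_mul_const _ (by fun_prop), lintegral_exp_mul_cosh_rpow hα, ← mul_assoc,
          ← mul_assoc, ← ENNReal.ofReal_mul (by positivity), ← ENNReal.ofReal_mul (by positivity)]
        congr 2
        rw [transferConst, show β - 2 = β - 1 - 1 by ring, Real.rpow_sub_one two_ne_zero (β - 1)]
        ring

/-- The even function `h(t) = ∫₀^∞ K_α(2x cosh t) f(x) dx` whose Fourier integral is the index
transform of `f`. -/
noncomputable def lebedevPreimage (α : ℝ) (f : ℝ → ℂ) (t : ℝ) : ℂ :=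
  ∫ x in Ioi (0 : ℝ), (macdonaldReal α (2 * x * Real.cosh t) : ℂ) * f x

theorem measurable_lebedevPreimage (α : ℝ) {f : ℝ → ℂ} (hf : Measurable f) :
    Measurable (lebedevPreimage α f) := by
  have h : StronglyMeasurable fun z : ℝ × ℝ =>
      (macdonaldReal α (2 * z.2 * Real.cosh z.1) : ℂ) * f z.2 := by
    refine Measurable.stronglyMeasurable (Measurable.mul ?_ (hf.comp measurable_snd))
    exact Complex.measurable_ofReal.comp ((measurable_macdonaldReal α).comp (by fun_prop))
  exact (h.integral_prod_right (ν := volume.restrict (Ioi 0))).measurable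

theorem enorm_lebedevPreimage_le {α β : ℝ} (hα : |α| < β) {p q : ℝ≥0∞} (hp : p ≠ 0) (hq0 : q ≠ 0)
    (hqt : q ≠ ∞) (hpq : ENNReal.HolderConjugate p q) {f : ℝ → ℂ}
    (hf : AEStronglyMeasurable f (volume.restrict (Ioi 0))) (t : ℝ) :
    ‖lebedevPreimage α f t‖ₑ ≤
      ENNReal.ofReal (transferConst α β q.toReal * Real.cosh t ^ (-β)) *
        weightedNorm (1 - β) p f := by
  refine (enorm_integral_le_lintegral_enorm _).trans ?_
  refine le_trans (le_of_eq ?_) (lintegral_macdonaldReal_mul_le hα hp hq0 hqt hpq hf t)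
  congr 1 with x
  rw [enorm_mul, ← ofReal_norm, Complex.norm_real, ofReal_norm]

/-- The `L^r` norm of `(cosh t) ^ (-β)` is a beta integral as well. -/
theorem eLpNorm_lebedevPreimage_le {α β : ℝ} (hα : |α| < β) {p q : ℝ≥0∞} (hp : p ≠ 0)
    (hq0 : q ≠ 0) (hqt : q ≠ ∞) (hpq : ENNReal.HolderConjugate p q) {f : ℝ → ℂ}
    (hf : AEStronglyMeasurable f (volume.restrict (Ioi 0))) {r : ℝ≥0∞} (hr0 : r ≠ 0)
    (hrt : r ≠ ∞) :
    eLpNorm (lebedevPreimage α f) r ≤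
      ENNReal.ofReal (transferConst α β q.toReal * (2 ^ (r.toReal * β - 1) *
        ProbabilityTheory.beta (r.toReal * β / 2) (r.toReal * β / 2)) ^ (1 / r.toReal)) *
        weightedNorm (1 - β) p f := by
  have hβ : 0 < β := (abs_nonneg α).trans_lt hα
  have hR : 0 < r.toReal := ENNReal.toReal_pos hr0 hrt
  have hC := transferConst_nonneg hα (ENNReal.toReal_pos hq0 hqt)
  set C := transferConst α β q.toReal
  set W := weightedNorm (1 - β) p f
  have hRβ : |(0 : ℝ)| < r.toReal * β := by rw [abs_zero]; positivity
  have hB := ProbabilityTheory.beta_pos (α := r.toReal * β / 2) (β := r.toReal * β / 2)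
    (by positivity) (by positivity)
  have hpow : ∀ t : ℝ, (ENNReal.ofReal (C * Real.cosh t ^ (-β)) * W) ^ r.toReal =
      (ENNReal.ofReal C * W) ^ r.toReal *
        ENNReal.ofReal (Real.exp (0 * t) * Real.cosh t ^ (-(r.toReal * β))) := by
    intro t
    have hc := Real.cosh_pos t
    rw [ENNReal.ofReal_mul hC, mul_right_comm, ENNReal.mul_rpow_of_nonneg _ _ hR.le,
      ENNReal.ofReal_rpow_of_pos (by positivity), ← Real.rpow_mul hc.le, zero_mul, Real.exp_zero,
      one_mul]
    congr 4
    ring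
  rw [eLpNorm_eq_lintegral_rpow_enorm_toReal hr0 hrt]
  calc (∫⁻ t, ‖lebedevPreimage α f t‖ₑ ^ r.toReal) ^ (1 / r.toReal)
      ≤ (∫⁻ t, (ENNReal.ofReal (C * Real.cosh t ^ (-β)) * W) ^ r.toReal) ^ (1 / r.toReal) := by
        gcongr with t
        exact enorm_lebedevPreimage_le hα hp hq0 hqt hpq hf t
    _ = _ := by
        simp_rw [hpow]
        rw [lintegral_const_mul _ (by fun_prop), lintegral_exp_mul_cosh_rpow hRβ, add_zero,
          sub_zero, ENNReal.mul_rpow_of_nonneg _ _ (by positivity), ← ENNReal.rpow_mul,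
          mul_one_div_cancel hR.ne', ENNReal.rpow_one, ENNReal.ofReal_rpow_of_pos (by positivity),
          mul_right_comm, ← ENNReal.ofReal_mul hC]

/-- The kernel of the double integral obtained by inserting the product formula into the index
transform is integrable. -/
theorem integrable_exp_mul_macdonaldReal_mul {α β : ℝ} (hα : |α| < β) {p q : ℝ≥0∞} (hp : p ≠ 0)
    (hq0 : q ≠ 0) (hqt : q ≠ ∞) (hpq : ENNReal.HolderConjugate p q) {f : ℝ → ℂ}
    (hf : Measurable f) (hW : weightedNorm (1 - β) p f < ∞) (τ : ℝ) :
    Integrable (fun z : ℝ × ℝ => Complex.exp (Complex.I * τ * z.2) *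
      macdonaldReal α (2 * z.1 * Real.cosh z.2) * f z.1)
      ((volume.restrict (Ioi 0)).prod volume) := by
  have hβ : |(0 : ℝ)| < β := by rw [abs_zero]; exact (abs_nonneg α).trans_lt hα
  have hC := transferConst_nonneg hα (ENNReal.toReal_pos hq0 hqt)
  have hm : Measurable fun z : ℝ × ℝ => Complex.exp (Complex.I * τ * z.2) *
      macdonaldReal α (2 * z.1 * Real.cosh z.2) * f z.1 := by
    refine Measurable.mul (Measurable.mul (by fun_prop) ?_) (hf.comp measurable_fst)
    exact Complex.measurable_ofReal.comp ((measurable_macdonaldReal α).comp (by fun_prop))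
  have hen : ∀ x t : ℝ, ‖Complex.exp (Complex.I * τ * t) *
      macdonaldReal α (2 * x * Real.cosh t) * f x‖ₑ =
      ‖macdonaldReal α (2 * x * Real.cosh t)‖ₑ * ‖f x‖ₑ := by
    intro x t
    have h1 : ‖Complex.exp (Complex.I * τ * t)‖ = 1 := by
      rw [Complex.norm_exp]; simp
    rw [enorm_mul, enorm_mul, ← ofReal_norm (Complex.exp _), h1, ENNReal.ofReal_one, one_mul,
      ← ofReal_norm (macdonaldReal _ _ : ℂ), Complex.norm_real, ofReal_norm]
  refine ⟨hm.aestronglyMeasurable, ?_⟩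
  rw [hasFiniteIntegral_iff_enorm, lintegral_prod_symm _ hm.enorm.aemeasurable]
  simp_rw [hen]
  refine (lintegral_mono fun t => lintegral_macdonaldReal_mul_le hα hp hq0 hqt hpq
    hf.aestronglyMeasurable t).trans_lt ?_
  have hpt : ∀ t : ℝ, ENNReal.ofReal (transferConst α β q.toReal * Real.cosh t ^ (-β)) =
      ENNReal.ofReal (transferConst α β q.toReal) *
        ENNReal.ofReal (Real.exp (0 * t) * Real.cosh t ^ (-β)) := fun t => by
    rw [ENNReal.ofReal_mul hC, zero_mul, Real.exp_zero, one_mul]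
  simp_rw [hpt]
  rw [lintegral_mul_const _ (by fun_prop), lintegral_const_mul _ (by fun_prop),
    lintegral_exp_mul_cosh_rpow hβ]
  exact ENNReal.mul_lt_top (ENNReal.mul_lt_top ENNReal.ofReal_lt_top ENNReal.ofReal_lt_top) hW

theorem lebedevKernel_mul_ae_eq (α τ : ℝ) (f : ℝ → ℂ) :
    (fun x : ℝ => (lebedevKernel α τ x : ℂ) * f x) =ᵐ[volume.restrict (Ioi 0)]
      fun x => ∫ t : ℝ, Complex.exp (Complex.I * τ * t) *
        macdonaldReal α (2 * x * Real.cosh t) * f x := by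
  filter_upwards [ae_restrict_mem measurableSet_Ioi] with x hx
  rw [integral_mul_const, lebedevKernel_eq_integral α τ hx]

theorem integrableOn_lebedevKernel_mul {α β : ℝ} (hα : |α| < β) {p q : ℝ≥0∞} (hp : p ≠ 0)
    (hq0 : q ≠ 0) (hqt : q ≠ ∞) (hpq : ENNReal.HolderConjugate p q) {f : ℝ → ℂ}
    (hf : Measurable f) (hW : weightedNorm (1 - β) p f < ∞) (τ : ℝ) :
    IntegrableOn (fun x : ℝ => (lebedevKernel α τ x : ℂ) * f x) (Ioi 0) :=
  (integrable_exp_mul_macdonaldReal_mul hα hp hq0 hqt hpq hf hW τ).integral_prod_left.congr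
    (lebedevKernel_mul_ae_eq α τ f).symm

/-- The index transform of `f` is the Fourier integral of `lebedevPreimage α f`. -/
theorem lebedevTransform_eq_integral {α β : ℝ} (hα : |α| < β) {p q : ℝ≥0∞} (hp : p ≠ 0)
    (hq0 : q ≠ 0) (hqt : q ≠ ∞) (hpq : ENNReal.HolderConjugate p q) {f : ℝ → ℂ}
    (hf : Measurable f) (hW : weightedNorm (1 - β) p f < ∞) (τ : ℝ) :
    lebedevTransform α f τ =
      ∫ t : ℝ, Complex.exp (Complex.I * τ * t) * lebedevPreimage α f t := by
  rw [lebedevTransform, integral_congr_ae (lebedevKernel_mul_ae_eq α τ f),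
    integral_integral_swap (integrable_exp_mul_macdonaldReal_mul hα hp hq0 hqt hpq hf hW τ)]
  simp_rw [lebedevPreimage, ← integral_const_mul, mul_assoc]

theorem lebedevTransform_congr_ae {α : ℝ} {f g : ℝ → ℂ}
    (h : f =ᵐ[volume.restrict (Ioi 0)] g) : lebedevTransform α f = lebedevTransform α g := by
  ext τ
  refine integral_congr_ae ?_
  filter_upwards [h] with x hx
  rw [hx]

theorem weightedNorm_congr_ae {ν : ℝ} {p : ℝ≥0∞} (hp : p ≠ 0) {f g : ℝ → ℂ}
    (h : f =ᵐ[volume.restrict (Ioi 0)] g) : weightedNorm ν p f = weightedNorm ν p g := by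
  rw [weightedNorm_eq_eLpNorm ν hp, weightedNorm_eq_eLpNorm ν hp]
  refine eLpNorm_congr_ae ?_
  filter_upwards [mulHaar_absolutelyContinuous.ae_le h] with x hx
  rw [hx]

/-- Measurability is kept as a separate condition with respect to Lebesgue measure on `(0, ∞)`, as in
the definition of `MemWeightedLp`. -/
theorem memWeightedLp_iff {ν : ℝ} {p : ℝ≥0∞} (hp : p ≠ 0) {f : ℝ → ℂ} :
    MemWeightedLp ν p f ↔ AEStronglyMeasurable f (volume.restrict (Ioi 0)) ∧
      MemLp (fun x => x ^ ν • f x) p mulHaar := by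
  rw [MemWeightedLp, weightedNorm_eq_eLpNorm ν hp]
  refine and_congr_right fun h => ⟨fun h' => ⟨?_, h'⟩, fun h' => h'.2⟩
  exact (by fun_prop : Measurable fun x : ℝ => x ^ ν).aestronglyMeasurable.smul
    (h.mono_ac mulHaar_absolutelyContinuous)

theorem MemWeightedLp.linear_combination {ν : ℝ} {p : ℝ≥0∞} (hp : p ≠ 0) {f g : ℝ → ℂ}
    (hf : MemWeightedLp ν p f) (hg : MemWeightedLp ν p g) (a b : ℂ) :
    MemWeightedLp ν p fun x => a * f x + b * g x := by
  rw [memWeightedLp_iff hp] at *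
  refine ⟨(hf.1.const_mul a).add (hg.1.const_mul b), ?_⟩
  convert (hf.2.const_mul a).add (hg.2.const_mul b) using 1
  ext x
  simp only [Pi.add_apply, Complex.real_smul]
  ring

/-- The Hausdorff–Young constant times the bound for the `L^q` norm of `lebedevPreimage`. With
`P = 0` the hypothesis reads `Q = 1` and `1 / P` is `0`, which covers `p = ∞`. -/
theorem transferConst_mul_eq {α ν P Q : ℝ} (hν : ν < 1) (hQ : 0 < Q) (hPQ : 1 / P + 1 / Q = 1) :
    (2 * Real.pi) ^ (1 / P) * (transferConst α (1 - ν) Q * (2 ^ (Q * (1 - ν) - 1) *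
        ProbabilityTheory.beta (Q * (1 - ν) / 2) (Q * (1 - ν) / 2)) ^ (1 / Q)) =
      Real.pi ^ (1 / P) * (2 : ℝ) ^ (-2 / Q - ν) * Q ^ (ν - 1) *
        Real.Gamma (Q / 2 * (1 - ν)) ^ (2 / Q) *
        ProbabilityTheory.beta ((1 - ν + α) / 2) ((1 - ν - α) / 2) := by
  have hβ : 0 < 1 - ν := by linarith
  have hpi := Real.pi_pos
  have hG := Real.Gamma_pos_of_pos (mul_pos hQ hβ)
  have hG2 := Real.Gamma_pos_of_pos (mul_pos (half_pos hQ) hβ)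
  have hbeta : ProbabilityTheory.beta (Q * (1 - ν) / 2) (Q * (1 - ν) / 2) =
      Real.Gamma (Q / 2 * (1 - ν)) ^ (2 : ℝ) * (Real.Gamma (Q * (1 - ν)))⁻¹ := by
    rw [ProbabilityTheory.beta, add_halves, Real.rpow_two, ← div_eq_mul_inv, sq,
      show Q * (1 - ν) / 2 = Q / 2 * (1 - ν) by ring]
  have hGG : Real.Gamma (Q * (1 - ν)) ^ (1 / Q) * (Real.Gamma (Q * (1 - ν)))⁻¹ ^ (1 / Q) = 1 := by
    rw [← Real.mul_rpow hG.le (by positivity), mul_inv_cancel₀ hG.ne', Real.one_rpow]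
  have h2 : (2 : ℝ) ^ (1 / P) * 2 ^ (-(1 - ν)) * 2 ^ (1 - ν - 2) *
      2 ^ ((Q * (1 - ν) - 1) * (1 / Q)) = 2 ^ (-2 / Q - ν) := by
    rw [← Real.rpow_add two_pos, ← Real.rpow_add two_pos, ← Real.rpow_add two_pos]
    congr 1
    rw [eq_sub_of_add_eq hPQ]
    field_simp
    ring
  rw [transferConst, hbeta, Real.mul_rpow (by positivity) (by positivity),
    Real.mul_rpow (by positivity) (by positivity), Real.mul_rpow (by positivity) (by positivity),
    Real.mul_rpow (by positivity) (by positivity), ← Real.rpow_mul hG2.le,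
    ← Real.rpow_mul (by norm_num), ← h2, show ν - 1 = -(1 - ν) by ring,
    show 2 * (1 / Q) = 2 / Q by ring]
  linear_combination (2 : ℝ) ^ (1 / P) * Real.pi ^ (1 / P) * 2 ^ (-(1 - ν)) * Q ^ (-(1 - ν)) *
    2 ^ (1 - ν - 2) * ProbabilityTheory.beta ((1 - ν + α) / 2) ((1 - ν - α) / 2) *
    2 ^ ((Q * (1 - ν) - 1) * (1 / Q)) * Real.Gamma (Q / 2 * (1 - ν)) ^ (2 / Q) * hGG

/-! ### The bound for the index transform -/

theorem corollary1 (α ν : ℝ) (p q : ℝ≥0∞) (hα : 0 ≤ α) (hαν : α + ν < 1) (hp : 2 ≤ p)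
    (hpq : ENNReal.HolderConjugate p q) :
    (∀ f : ℝ → ℂ, MemWeightedLp ν p f →
      (∀ τ : ℝ, IntegrableOn (fun x : ℝ => (lebedevKernel α τ x : ℂ) * f x) (Ioi 0)) ∧
      MemLp (lebedevTransform α f) p volume ∧
      eLpNorm (lebedevTransform α f) p volume ≤
        ENNReal.ofReal
          (Real.pi ^ (1 / p.toReal) * (2 : ℝ) ^ (-2 / q.toReal - ν) * q.toReal ^ (ν - 1) *
            Real.Gamma (q.toReal / 2 * (1 - ν)) ^ (2 / q.toReal) *
            ProbabilityTheory.beta ((1 - ν + α) / 2) ((1 - ν - α) / 2)) *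
          weightedNorm ν p f) ∧
    (∀ f g : ℝ → ℂ, MemWeightedLp ν p f → MemWeightedLp ν p g → ∀ a b : ℂ,
      MemWeightedLp ν p (fun x => a * f x + b * g x) ∧
      ∀ τ : ℝ, lebedevTransform α (fun x => a * f x + b * g x) τ =
        a * lebedevTransform α f τ + b * lebedevTransform α g τ) := by
  have hp0 : p ≠ 0 := (lt_of_lt_of_le (by norm_num) hp).ne'
  have hq0 : q ≠ 0 := ENNReal.HolderConjugate.ne_zero q p
  have hqt : q ≠ ∞ := by
    have h1 : 1 < p := lt_of_lt_of_le (by norm_num) hp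
    exact ((ENNReal.HolderConjugate.lt_top_iff_one_lt q p).2 h1).ne
  have hQ : 0 < q.toReal := ENNReal.toReal_pos hq0 hqt
  have hαβ : |α| < 1 - ν := by rw [abs_of_nonneg hα]; linarith
  have hν : 1 - (1 - ν) = ν := by ring
  have hPQ : 1 / p.toReal + 1 / q.toReal = 1 := by
    have := congrArg ENNReal.toReal (ENNReal.HolderConjugate.inv_add_inv_eq_one p q)
    rwa [ENNReal.toReal_add (by simpa using hp0) (by simpa using hq0), ENNReal.toReal_inv,
      ENNReal.toReal_inv, ENNReal.toReal_one, ← one_div, ← one_div] at this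
  -- everything depends only on the class of `f` almost everywhere on `(0, ∞)`
  have hint : ∀ f : ℝ → ℂ, MemWeightedLp ν p f → ∀ τ : ℝ,
      IntegrableOn (fun x : ℝ => (lebedevKernel α τ x : ℂ) * f x) (Ioi 0) := by
    intro f hf τ
    have hW := weightedNorm_congr_ae (ν := ν) hp0 hf.1.ae_eq_mk
    refine (integrableOn_lebedevKernel_mul hαβ hp0 hq0 hqt hpq hf.1.stronglyMeasurable_mk.measurable
      (by rw [hν, ← hW]; exact hf.2) τ).congr ?_
    filter_upwards [hf.1.ae_eq_mk] with x hx
    rw [hx]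
  have hbound : ∀ f : ℝ → ℂ, MemWeightedLp ν p f →
      MemLp (lebedevTransform α f) p volume ∧
      eLpNorm (lebedevTransform α f) p volume ≤
        ENNReal.ofReal
          (Real.pi ^ (1 / p.toReal) * (2 : ℝ) ^ (-2 / q.toReal - ν) * q.toReal ^ (ν - 1) *
            Real.Gamma (q.toReal / 2 * (1 - ν)) ^ (2 / q.toReal) *
            ProbabilityTheory.beta ((1 - ν + α) / 2) ((1 - ν - α) / 2)) *
          weightedNorm ν p f := by
    intro f hf
    have hg := hf.1.stronglyMeasurable_mk.measurable
    set g := hf.1.mk f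
    have hW : weightedNorm ν p f = weightedNorm ν p g := weightedNorm_congr_ae hp0 hf.1.ae_eq_mk
    have hWt : weightedNorm (1 - (1 - ν)) p g < ∞ := by rw [hν, ← hW]; exact hf.2
    have hT : lebedevTransform α f =
        fun τ : ℝ => ∫ t : ℝ, Complex.exp (Complex.I * τ * t) * lebedevPreimage α g t := by
      rw [lebedevTransform_congr_ae hf.1.ae_eq_mk]
      ext τ
      exact lebedevTransform_eq_integral hαβ hp0 hq0 hqt hpq hg hWt τ
    have hhm := measurable_lebedevPreimage α hg
    have hmem : ∀ r : ℝ≥0∞, r ≠ 0 → r ≠ ∞ → MemLp (lebedevPreimage α g) r := fun r h0 ht =>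
      ⟨hhm.aestronglyMeasurable, (eLpNorm_lebedevPreimage_le hαβ hp0 hq0 hqt hpq
        hg.aestronglyMeasurable h0 ht).trans_lt (ENNReal.mul_lt_top ENNReal.ofReal_lt_top hWt)⟩
    have hh1 : Integrable (lebedevPreimage α g) :=
      memLp_one_iff_integrable.1 (hmem 1 one_ne_zero ENNReal.one_ne_top)
    have hle : eLpNorm (lebedevTransform α f) p volume ≤
        ENNReal.ofReal
          (Real.pi ^ (1 / p.toReal) * (2 : ℝ) ^ (-2 / q.toReal - ν) * q.toReal ^ (ν - 1) *
            Real.Gamma (q.toReal / 2 * (1 - ν)) ^ (2 / q.toReal) *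
            ProbabilityTheory.beta ((1 - ν + α) / 2) ((1 - ν - α) / 2)) *
          weightedNorm ν p f := by
      rw [hT, ← transferConst_mul_eq (by linarith) hQ hPQ, ENNReal.ofReal_mul (by positivity),
        mul_assoc, hW]
      refine (eLpNorm_integral_exp_mul_le hp hpq hhm hh1 (hmem q hq0 hqt)).trans ?_
      gcongr
      have := eLpNorm_lebedevPreimage_le hαβ hp0 hq0 hqt hpq hg.aestronglyMeasurable hq0 hqt
      rwa [hν] at this
    refine ⟨⟨?_, hle.trans_lt (ENNReal.mul_lt_top ENNReal.ofReal_lt_top hf.2)⟩, hle⟩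
    rw [hT]
    exact (continuous_integral_exp_mul hh1).aestronglyMeasurable
  refine ⟨fun f hf => ⟨hint f hf, hbound f hf⟩, fun f g hf hg a b =>
    ⟨hf.linear_combination hp0 hg a b, fun τ => ?_⟩⟩
  simp only [lebedevTransform]
  rw [← integral_const_mul, ← integral_const_mul,
    ← integral_add ((hint f hf τ).const_mul a) ((hint g hg τ).const_mul b)]
  congr 1 with x
  ring
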